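/- Let $X$ be a compact connected Riemann surface with holomorphic cotangent bundle $K_X$, and let $D\subset X$ be a finite subset. A parabolic bundle $E_*$ is a holomorphic vector bundle $E$ on $X$ with, at each $p\in D$, a strictly decreasing flag $E_p=E_p^1\supsetneq\cdots\supsetneq E_p^{n_p}\supsetneq E_p^{n_p+1}=0$ and weights $0\le\alpha_{p,1}<\cdots<\alpha_{p,n_p}<1$. For $t=m+\tau$ with $m\in\mathbb Z$, $0\le\tau<1$, let $E_t$ be the sheaf of sections of $E(-mD)$ whose leading coefficient at each $p\in D$ lies in the largest $E_p^j$ with $\alpha_{p,j}\ge\tau$ (in $0$ if there is none). All these sheaves, and those below, are subsheaves of the direct image of sheaves of sections over $X\setminus D$. A homomorphism of parabolic bundles is a homomorphism over $X\setminus D$ that maps the $t$-th sheaf into the $t$-th sheaf for every $t\in\mathbb R$; an isomorphism is one with an inverse homomorphism. The parabolic tensor product is given by $(E_*\otimes F_*)_t=\sum_{a+b\ge t}E_a\otimes F_b$; the parabolic dual by letting $(E_*^*)_t$ be the sheaf of functionals that carry $E_a$ into $\mathcal O_X(-\lceil a+t\rceil D)$ for all $a$; $\mathrm{Sym}^2(E_*)$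 and $\bigwedge^2E_*$ are the symmetric and antisymmetric tensors in $E_*\otimes E_*$. The line bundle $K_X(D)$ has the trivial parabolic structure (weight $0$), and $H^0(X,V_*)$ denotes the global sections of $V_0$. Let $E_*$ be a parabolic bundle and $L_*$ a parabolic line bundle. A homomorphism $\phi:E_*\otimes E_*\to L_*$ is a parabolic symplectic (respectively, orthogonal) structure if it is antisymmetric (respectively, symmetric) over $X\setminus D$ and the adjoint map $\widehat\phi:E_*\to E_*^*\otimes L_*$, $u\mapsto\phi(u\otimes\,\cdot\,)$, is an isomorphism of parabolic bundles. A parabolic Higgs field is a section $\theta\in H^0(X,\mathrm{ad}_P(E)\otimes K_X(D))$, where $\mathrm{ad}_P(E)$ is the sheaf of trace-free holomorphic endomorphisms of $E$ that preserve the flags over $D$. It is compatible with $\phi$ if $$(\phi\otimes\mathrm{Id}_{K_X(D)})(\theta(u)\otimes v)+(\phi\otimes\mathrm{Id}_{K_X(D)})(u\otimes\theta(v))=0$$ for all local holomorphic sections $u,v$ of $E$. Let $\widetilde\theta$ be the image of $\theta$ under the isomorphism $$\mathrm{End}(E_*)\cong E_*\otimes E_*^*\otimes L_*\otimes L_*^*\xrightarrow{\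 \mathrm{Id}\otimes\widehat\phi^{-1}\otimes\mathrm{Id}\ }E_*\otimes E_*\otimes L_*^*$$ tensored with $K_X(D)$. Let $\theta$ be a parabolic Higgs field on $E_*$. (1) A parabolic symplectic structure $\phi:E_*\otimes E_*\to L_*$ is compatible with $\theta$ if and only if $\widetilde\theta\in H^0\big(X,\mathrm{Sym}^2(E_*)\otimes L_*^*\otimes K_X(D)\big)$. (2) A parabolic orthogonal structure $\phi:E_*\otimes E_*\to L_*$ is compatible with $\theta$ if and only if $\widetilde\theta\in H^0\big(X,\big(\bigwedge^2E_*\big)\otimes L_*^*\otimes K_X(D)\big)$. -/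

import Mathlib

open Bundle TopologicalSpace
open scoped Manifold ContDiff Topology TensorProduct

noncomputable section

namespace ParabolicHiggs

/-! ### Linear algebra in one fibre -/

section LinearAlgebra

variable {V L K : Type*} [AddCommGroup V] [Module ℂ V] [AddCommGroup L] [Module ℂ L]
  [AddCommGroup K] [Module ℂ K]

/-- The map `V → V^* ⊗ L` adjoint to a pairing `φ : V ⊗ V → L`: it sends `u` to the element of
`V^* ⊗ L = Hom(V, L)` given by `v ↦ φ (u ⊗ v)`. -/
def hat [FiniteDimensional ℂ V] (φ : V ⊗[ℂ] V →ₗ[ℂ] L) : V →ₗ[ℂ] Module.Dual ℂ V ⊗[ℂ] L :=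
  (dualTensorHomEquiv ℂ V L).symm.toLinearMap ∘ₗ TensorProduct.curry φ

theorem contractRight_bijective (hL : Module.finrank ℂ L = 1) :
    Function.Bijective (contractRight ℂ L) := by
  have : FiniteDimensional ℂ L := Module.finite_of_finrank_eq_succ hL
  have : Nontrivial L := Module.nontrivial_of_finrank_pos (R := ℂ) (by omega)
  have hs : Function.Surjective (contractRight ℂ L) := by
    obtain ⟨v, hv⟩ := exists_ne (0 : L)
    obtain ⟨f, hfv⟩ : ∃ f : Module.Dual ℂ L, f v ≠ 0 := by
      by_contra! h
      exact hv ((Module.forall_dual_apply_eq_zero_iff ℂ v).1 h)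
    intro c
    exact ⟨(c / f v) • (v ⊗ₜ f), by simp [contractRight_apply, hfv]⟩
  exact ⟨(LinearMap.injective_iff_surjective_of_finrank_eq_finrank
    (by simp [Module.finrank_tensorProduct, Subspace.dual_finrank_eq, hL])).2 hs, hs⟩

/-- The canonical isomorphism `L ⊗ L^* ≅ ℂ` for a line `L`. -/
def lineContract (hL : Module.finrank ℂ L = 1) : L ⊗[ℂ] Module.Dual ℂ L ≃ₗ[ℂ] ℂ :=
  LinearEquiv.ofBijective (contractRight ℂ L) (contractRight_bijective hL)

/-- The isomorphism
`End V ≅ V ⊗ V^* ≅ V ⊗ (V^* ⊗ L) ⊗ L^* ≅ V ⊗ V ⊗ L^*`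
induced by an isomorphism `e : V ≅ V^* ⊗ L`; the last step is `id ⊗ e⁻¹ ⊗ id`. -/
def endEquiv [FiniteDimensional ℂ V] (hL : Module.finrank ℂ L = 1)
    (e : V ≃ₗ[ℂ] Module.Dual ℂ V ⊗[ℂ] L) :
    Module.End ℂ V ≃ₗ[ℂ] (V ⊗[ℂ] V) ⊗[ℂ] Module.Dual ℂ L :=
  -- `End V ≅ V^* ⊗ V`
  (dualTensorHomEquiv ℂ V V).symm ≪≫ₗ
  -- `≅ V ⊗ V^*`
  TensorProduct.comm ℂ (Module.Dual ℂ V) V ≪≫ₗ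
  -- `≅ (V ⊗ V^*) ⊗ ℂ`
  (TensorProduct.rid ℂ (V ⊗[ℂ] Module.Dual ℂ V)).symm ≪≫ₗ
  -- `≅ (V ⊗ V^*) ⊗ (L ⊗ L^*)`
  TensorProduct.congr (LinearEquiv.refl ℂ (V ⊗[ℂ] Module.Dual ℂ V)) (lineContract hL).symm ≪≫ₗ
  -- `≅ ((V ⊗ V^*) ⊗ L) ⊗ L^*`
  (TensorProduct.assoc ℂ (V ⊗[ℂ] Module.Dual ℂ V) L (Module.Dual ℂ L)).symm ≪≫ₗ
  -- `≅ (V ⊗ (V^* ⊗ L)) ⊗ L^*`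
  TensorProduct.congr (TensorProduct.assoc ℂ V (Module.Dual ℂ V) L)
    (LinearEquiv.refl ℂ (Module.Dual ℂ L)) ≪≫ₗ
  -- `≅ (V ⊗ V) ⊗ L^*`
  TensorProduct.congr (TensorProduct.congr (LinearEquiv.refl ℂ V) e.symm)
    (LinearEquiv.refl ℂ (Module.Dual ℂ L))

/-- For `θ ∈ End V ⊗ K` and `u ∈ V`, the vector `θ(u) ∈ V ⊗ K`. -/
def higgsApply (θ : Module.End ℂ V ⊗[ℂ] K) (u : V) : V ⊗[ℂ] K :=
  LinearMap.rTensor K (LinearMap.applyₗ u) θ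

/-- `(φ ⊗ id_K)(w ⊗ v) ∈ L ⊗ K` for `w ∈ V ⊗ K` and `v ∈ V`. -/
def pairLeft (φ : V ⊗[ℂ] V →ₗ[ℂ] L) (w : V ⊗[ℂ] K) (v : V) : L ⊗[ℂ] K :=
  LinearMap.rTensor K ((TensorProduct.curry φ).flip v) w

/-- `(φ ⊗ id_K)(u ⊗ w) ∈ L ⊗ K` for `u ∈ V` and `w ∈ V ⊗ K`. -/
def pairRight (φ : V ⊗[ℂ] V →ₗ[ℂ] L) (u : V) (w : V ⊗[ℂ] K) : L ⊗[ℂ] K :=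
  LinearMap.rTensor K (TensorProduct.curry φ u) w

end LinearAlgebra

/-! ### Filtered sheaves on a Riemann surface with marked points -/

variable {X : Type*} [TopologicalSpace X]

/-- The complement `X ∖ D` of the set of marked points. -/
abbrev Cpl (D : Finset X) : Type _ := {x : X // x ∉ D}

/-- A real-indexed family of subsheaves `V_t` (`t ∈ ℝ`) of `j_* V`, for a family `V` of vector
spaces over `X ∖ D` and the inclusion `j : X ∖ D → X`: the set `P t U` consists of those `s` whose
restriction to `U ∖ D` is a section of `V_t` over `U`.  All instances used below are explicit
constructions, in which membership depends only on `s` restricted to `U ∖ D`. -/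
abbrev Filtered (D : Finset X) (V : Cpl D → Type*) : Type _ :=
  ℝ → Opens X → Set (∀ x : Cpl D, V x)

section Operations

variable {D : Finset X} {V W : Cpl D → Type*}
  [∀ x, AddCommGroup (V x)] [∀ x, Module ℂ (V x)]
  [∀ x, AddCommGroup (W x)] [∀ x, Module ℂ (W x)]

/-- The parabolic tensor product: `(V ⊗ W)_t` is the subsheaf of `j_*(V ⊗ W)` generated by all
`V_a ⊗ W_b` with `a + b ≥ t`. -/
def tensor (P : Filtered D V) (Q : Filtered D W) :
    Filtered D (fun x => V x ⊗[ℂ] W x) :=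
  fun t U => {σ | ∀ y ∈ U, ∃ N : Opens X, y ∈ N ∧ N ≤ U ∧
    ∃ (n : ℕ) (a b : Fin n → ℝ) (e : Fin n → ∀ x, V x) (f : Fin n → ∀ x, W x),
      (∀ k, t ≤ a k + b k ∧ e k ∈ P (a k) N ∧ f k ∈ Q (b k) N) ∧
      ∀ x : Cpl D, x.1 ∈ N → σ x = ∑ k, e k x ⊗ₜ[ℂ] f k x}

/-- The parabolic symmetric square, the subsheaf of symmetric tensors in the parabolic tensor
square. -/
def sym2 (P : Filtered D V) : Filtered D (fun x => V x ⊗[ℂ] V x) :=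
  fun t U => {σ | σ ∈ tensor P P t U ∧
    ∀ x : Cpl D, x.1 ∈ U → TensorProduct.comm ℂ (V x) (V x) (σ x) = σ x}

/-- The parabolic exterior square, the subsheaf of antisymmetric tensors in the parabolic tensor
square. -/
def wedge2 (P : Filtered D V) : Filtered D (fun x => V x ⊗[ℂ] V x) :=
  fun t U => {σ | σ ∈ tensor P P t U ∧
    ∀ x : Cpl D, x.1 ∈ U → TensorProduct.comm ℂ (V x) (V x) (σ x) = -σ x}

/-- A homomorphism of filtered sheaves: a family of linear maps over `X ∖ D` that carries `V_t`
into `W_t` for every `t`. -/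
def IsHom (P : Filtered D V) (Q : Filtered D W) (f : ∀ x, V x →ₗ[ℂ] W x) : Prop :=
  ∀ (t : ℝ) (U : Opens X) (s : ∀ x, V x), s ∈ P t U → (fun x => f x (s x)) ∈ Q t U

/-- An isomorphism of filtered sheaves: a homomorphism with an inverse homomorphism. -/
def IsIso (P : Filtered D V) (Q : Filtered D W) (f : ∀ x, V x →ₗ[ℂ] W x) : Prop :=
  IsHom P Q f ∧ ∃ g : ∀ x, W x →ₗ[ℂ] V x, IsHom Q P g ∧
    (∀ x, g x ∘ₗ f x = LinearMap.id) ∧ ∀ x, f x ∘ₗ g x = LinearMap.id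

theorem IsIso.bijective {P : Filtered D V} {Q : Filtered D W} {f : ∀ x, V x →ₗ[ℂ] W x}
    (h : IsIso P Q f) (x : Cpl D) : Function.Bijective (f x) := by
  obtain ⟨_, g, _, h1, h2⟩ := h
  exact Function.bijective_iff_has_inverse.2
    ⟨g x, fun v => LinearMap.congr_fun (h1 x) v, fun w => LinearMap.congr_fun (h2 x) w⟩

end Operations

/-! ### Parabolic bundles -/

section Bundles

variable [ChartedSpace ℂ X]

section OneBundle

variable (F : Type*) [NormedAddCommGroup F] [NormedSpace ℂ F]
  {E : X → Type*} [TopologicalSpace (TotalSpace F E)]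
  [∀ x, TopologicalSpace (E x)] [FiberBundle F E]

/-- The section `g` of the holomorphic bundle `E` is holomorphic on a neighbourhood of `y`. -/
def HolAt (g : ∀ x, E x) (y : X) : Prop :=
  ContMDiffAt 𝓘(ℂ, ℂ) (𝓘(ℂ, ℂ).prod 𝓘(ℂ, F)) ω (fun x => TotalSpace.mk' F x (g x)) y

variable [∀ x, AddCommGroup (E x)] [∀ x, Module ℂ (E x)] {D : Finset X}

/-- Near `y` and off `D`, the section `s` has the form `z ^ m • g`, where `z` is a local coordinate
centred at `y`, and `g` is a holomorphic section of `E` near `y` whose value at `y` lies in `S`. -/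
def GermAt (y : X) (m : ℤ) (S : Submodule ℂ (E y)) (s : ∀ x : Cpl D, E x.1) : Prop :=
  ∃ g : ∀ x, E x, HolAt F g y ∧ g y ∈ S ∧
    ∀ᶠ x in 𝓝 y, ∀ h : x ∉ D, s ⟨x, h⟩ = (chartAt ℂ y x - chartAt ℂ y y) ^ m • g x

variable (D) in
/-- The holomorphic bundle `E(kD) = E ⊗ 𝒪(kD)` with the trivial parabolic structure (weight `0`):
its `t`-th sheaf is `E((k - ⌈t⌉)D)`. -/
def twisted (E : X → Type*) [TopologicalSpace (TotalSpace F E)] [∀ x, TopologicalSpace (E x)]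
    [FiberBundle F E] [∀ x, AddCommGroup (E x)] [∀ x, Module ℂ (E x)] (k : ℤ) :
    Filtered D (fun x => E x.1) :=
  fun t U => {s | ∀ y ∈ U,
    (y ∉ D → GermAt F y 0 ⊤ s) ∧ (y ∈ D → GermAt F y (⌈t⌉ - k) ⊤ s)}

end OneBundle

/-- A parabolic structure on `E` over `D`: at every `p ∈ D` a strictly decreasing flag
`E_p = E¹ ⊋ E² ⊋ ⋯ ⊋ Eⁿ ⊋ Eⁿ⁺¹ = 0` and weights `0 ≤ α₁ < ⋯ < αₙ < 1` (indices here start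
at `0`). -/
structure ParabolicStructure (D : Finset X) (E : X → Type*) [∀ x, AddCommGroup (E x)]
    [∀ x, Module ℂ (E x)] where
  len : D → ℕ
  flag : ∀ p : D, Fin (len p + 1) → Submodule ℂ (E p.1)
  flag_strictAnti : ∀ p, StrictAnti (flag p)
  flag_zero : ∀ p, flag p 0 = ⊤
  flag_last : ∀ p, flag p (Fin.last (len p)) = ⊥
  weight : ∀ p : D, Fin (len p) → ℝ
  weight_strictMono : ∀ p, StrictMono (weight p)
  weight_nonneg : ∀ p j, 0 ≤ weight p j
  weight_lt_one : ∀ p j, weight p j < 1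

namespace ParabolicStructure

variable {D : Finset X} {E : X → Type*} [∀ x, AddCommGroup (E x)] [∀ x, Module ℂ (E x)]

/-- The largest member of the flag at `p` whose weight is at least `τ` (zero if there is none). -/
def flagAt (P : ParabolicStructure D E) (p : D) (τ : ℝ) : Submodule ℂ (E p.1) :=
  ⨆ (j : Fin (P.len p)) (_ : τ ≤ P.weight p j), P.flag p j.castSucc

variable (F : Type*) [NormedAddCommGroup F] [NormedSpace ℂ F]
  [TopologicalSpace (TotalSpace F E)] [∀ x, TopologicalSpace (E x)] [FiberBundle F E]

/-- The filtered sheaf of a parabolic bundle: for `t = m + τ` with `m ∈ ℤ` and `0 ≤ τ < 1`, the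
sections of `E_t` are the sections of `E(-mD)` whose leading coefficient at every point `p` of `D`
lies in the part of the flag at `p` of weight at least `τ`. -/
def filtered (P : ParabolicStructure D E) : Filtered D (fun x => E x.1) :=
  fun t U => {s | ∀ y ∈ U, (y ∉ D → GermAt F y 0 ⊤ s) ∧
    ∀ h : y ∈ D, GermAt F y ⌊t⌋ (P.flagAt ⟨y, h⟩ (Int.fract t)) s}

/-- Sections over `U` of the sheaf of trace-free holomorphic endomorphisms of `E` that preserve
the flags. -/
def IsAdP (P : ParabolicStructure D E) (U : Opens X) (A : ∀ x, Module.End ℂ (E x)) : Prop :=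
  (∀ y ∈ U, ∀ g : ∀ x, E x, HolAt F g y → HolAt F (fun x => A x (g x)) y) ∧
  (∀ y ∈ U, LinearMap.trace ℂ (E y) (A y) = 0) ∧
  ∀ p : D, p.1 ∈ U → ∀ j, ∀ v ∈ P.flag p j, A p.1 v ∈ P.flag p j

end ParabolicStructure

/-- The trivial bundle `𝒪_X` with the trivial parabolic structure. -/
def structureSheaf (D : Finset X) : Filtered D (fun _ => ℂ) :=
  twisted (E := Bundle.Trivial X ℂ) ℂ D 0

/-- The parabolic dual: `(V^*)_t` consists of the functionals carrying `V_a` into `𝒪_{a+t}` for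
every `a`. -/
def dual {D : Finset X} {V : Cpl D → Type*} [∀ x, AddCommGroup (V x)] [∀ x, Module ℂ (V x)]
    (P : Filtered D V) : Filtered D (fun x => Module.Dual ℂ (V x)) :=
  fun t U => {σ | ∀ N : Opens X, N ≤ U → ∀ (a : ℝ) (e : ∀ x, V x), e ∈ P a N →
    (fun x => σ x (e x)) ∈ structureSheaf D (a + t) N}

variable [IsManifold 𝓘(ℂ, ℂ) ω X]

/-- The fibre at `x` of the holomorphic cotangent bundle `K_X`. -/
abbrev Cotangent (x : X) : Type :=
  TangentSpace 𝓘(ℂ, ℂ) x →L[ℂ] Bundle.Trivial X ℂ x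

variable (X) in
/-- The line bundle `K_X(D)` with the trivial parabolic structure; its sections are the meromorphic
`1`-forms with at most simple poles on `D`. -/
def canonicalLog (D : Finset X) : Filtered D (fun x => Cotangent (X := X) x.1) :=
  twisted (E := fun x : X => Cotangent x) (ℂ →L[ℂ] ℂ) D 1

section Main

variable {D : Finset X}
  (FE : Type*) [NormedAddCommGroup FE] [NormedSpace ℂ FE]
  {E : X → Type*} [∀ x, AddCommGroup (E x)] [∀ x, Module ℂ (E x)]
  [TopologicalSpace (TotalSpace FE E)] [∀ x, TopologicalSpace (E x)] [FiberBundle FE E]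

/-- A parabolic Higgs field on `E_*`: a global section of `ad_P(E) ⊗ K_X(D)`, given by its
restriction to `X ∖ D`. -/
def IsHiggsField (P : ParabolicStructure D E)
    (θ : ∀ x : Cpl D, Module.End ℂ (E x.1) ⊗[ℂ] Cotangent x.1) : Prop :=
  ∀ y : X, ∃ N : Opens X, y ∈ N ∧
    ∃ (n : ℕ) (A : Fin n → ∀ x, Module.End ℂ (E x)) (η : Fin n → ∀ x : Cpl D, Cotangent x.1),
      (∀ k, P.IsAdP FE N (A k) ∧ η k ∈ canonicalLog X D 0 N) ∧
      ∀ x : Cpl D, x.1 ∈ N → θ x = ∑ k, A k x.1 ⊗ₜ[ℂ] η k x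

variable {L : X → Type*} [∀ x, AddCommGroup (L x)] [∀ x, Module ℂ (L x)]

/-- Compatibility of a Higgs field `θ` with a pairing `φ`:
`(φ ⊗ id)(θ(u) ⊗ v) + (φ ⊗ id)(u ⊗ θ(v)) = 0` for all local holomorphic sections `u`, `v` of `E`.
(This is an identity of sections of `L ⊗ K_X(D)`, checked off `D`.) -/
def IsCompatible (φ : ∀ x : Cpl D, E x.1 ⊗[ℂ] E x.1 →ₗ[ℂ] L x.1)
    (θ : ∀ x : Cpl D, Module.End ℂ (E x.1) ⊗[ℂ] Cotangent x.1) : Prop :=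
  ∀ (U : Opens X) (u v : ∀ x, E x), (∀ y ∈ U, HolAt FE u y) → (∀ y ∈ U, HolAt FE v y) →
    ∀ x : Cpl D, x.1 ∈ U →
      pairLeft (φ x) (higgsApply (θ x) (u x.1)) (v x.1) +
        pairRight (φ x) (u x.1) (higgsApply (θ x) (v x.1)) = 0

variable [∀ x, FiniteDimensional ℂ (E x)]
  (FL : Type*) [NormedAddCommGroup FL] [NormedSpace ℂ FL]
  [TopologicalSpace (TotalSpace FL L)] [∀ x, TopologicalSpace (L x)] [FiberBundle FL L]

/-- `φ` is a homomorphism `E_* ⊗ E_* → L_*` of parabolic bundles whose adjoint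
`E_* → E_*^* ⊗ L_*` is an isomorphism of parabolic bundles. -/
structure IsPerfect (P : ParabolicStructure D E) (Q : ParabolicStructure D L)
    (φ : ∀ x : Cpl D, E x.1 ⊗[ℂ] E x.1 →ₗ[ℂ] L x.1) : Prop where
  isHom : IsHom (tensor (P.filtered FE) (P.filtered FE)) (Q.filtered FL) φ
  isIso : IsIso (P.filtered FE) (tensor (dual (P.filtered FE)) (Q.filtered FL))
    (fun x => hat (φ x))

/-- An `L_*`-valued parabolic symplectic structure on `E_*`. -/
structure IsSymplectic (P : ParabolicStructure D E) (Q : ParabolicStructure D L)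
    (φ : ∀ x : Cpl D, E x.1 ⊗[ℂ] E x.1 →ₗ[ℂ] L x.1) : Prop extends IsPerfect FE FL P Q φ where
  antisymm : ∀ (x : Cpl D) (u v : E x.1), φ x (u ⊗ₜ v) = -φ x (v ⊗ₜ u)

/-- An `L_*`-valued parabolic orthogonal structure on `E_*`. -/
structure IsOrthogonal (P : ParabolicStructure D E) (Q : ParabolicStructure D L)
    (φ : ∀ x : Cpl D, E x.1 ⊗[ℂ] E x.1 →ₗ[ℂ] L x.1) : Prop extends IsPerfect FE FL P Q φ where
  symm : ∀ (x : Cpl D) (u v : E x.1), φ x (u ⊗ₜ v) = φ x (v ⊗ₜ u)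

variable {FE FL}

/-- The image of `θ` under the isomorphism
`End(E_*) ⊗ K_X(D) ≅ E_* ⊗ E_* ⊗ L_*^* ⊗ K_X(D)` induced by the adjoint of `φ`. -/
def higgsTensor {P : ParabolicStructure D E} {Q : ParabolicStructure D L}
    {φ : ∀ x : Cpl D, E x.1 ⊗[ℂ] E x.1 →ₗ[ℂ] L x.1} (hφ : IsPerfect FE FL P Q φ)
    (hL : ∀ x, Module.finrank ℂ (L x) = 1)
    (θ : ∀ x : Cpl D, Module.End ℂ (E x.1) ⊗[ℂ] Cotangent x.1) (x : Cpl D) :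
    ((E x.1 ⊗[ℂ] E x.1) ⊗[ℂ] Module.Dual ℂ (L x.1)) ⊗[ℂ] Cotangent x.1 :=
  LinearMap.rTensor (Cotangent x.1)
    (endEquiv (hL x.1) (LinearEquiv.ofBijective (hat (φ x)) (hφ.isIso.bijective x))).toLinearMap
    (θ x)

end Main

end Bundles

end ParabolicHiggs

end

namespace ParabolicHiggs

/-! ### The compatibility condition in one fibre -/

section LinearAlgebra

variable {V L K M N : Type*} [AddCommGroup V] [Module ℂ V] [AddCommGroup L] [Module ℂ L]
  [AddCommGroup K] [Module ℂ K] [AddCommGroup M] [Module ℂ M] [AddCommGroup N] [Module ℂ N]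

/-! Write `δ = 1` in the symplectic and `δ = -1` in the orthogonal case, so that `φ(u, v) = -δ φ(v,
u)`. In one fibre over `X ∖ D`, a tensor `w ⊗ h ⊗ λ` in `V ⊗ V ⊗ L^*` defines the pairing `(u, v) ↦
λ(φ(h, u)) φ(w, v)`. The tensor attached to an endomorphism `A` defines `φ(Au, v)`
(`tensorPairing_endEquiv`); exchanging its first two factors swaps `u` and `v`, because `L` is a
line (`tensorPairing_exchange`); and the pairings separate tensors, because `φ` is perfect
(`eq_zero_of_tensorPairing`). Since `φ(u, Av) = -δ φ(Av, u)`, invariance of `φ` under `A` says that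
the tensor of `A` equals `δ` times its exchange. Contracting with functionals on `K` extends this to
`θ` (`compatible_iff_exchange`).

It remains to pass from symmetry in the fibres to membership in the sheaf generated by products,
including at the points of `D`. Near each point, frames adapted to the flags give `id = ∑ cᵢ ⊗ eᵢ`
with `eᵢ` in `E_{aᵢ}` and `cᵢ` in `(E^*)_{-aᵢ}` (`exists_local_frame`), and similarly `lⱼ`, `mⱼ`
with weights `bⱼ`, `-bⱼ` for `L`. As `φ̂⁻¹` is a parabolic homomorphism, the tensor of `A` is a sum
of terms `A eᵢ ⊗ φ̂⁻¹(cᵢ ⊗ lⱼ) ⊗ mⱼ` whose weights `aᵢ`, `bⱼ - aᵢ`, `-bⱼ` add up to `0`. Averaging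
with the exchange makes each `E ⊗ E` factor `δ`-symmetric without changing the total
(`higgsTensor_mem_of_exchange`). Conversely, sums of products with `δ`-symmetric factors are
`δ`-symmetric in every fibre (`exchange_eq_of_mem`). -/

/-- Contraction of the second factor of `M ⊗ K` with a functional on `K`. -/
noncomputable def contractWith (M : Type*) [AddCommGroup M] [Module ℂ M] (κ : Module.Dual ℂ K) :
    M ⊗[ℂ] K →ₗ[ℂ] M :=
  (TensorProduct.rid ℂ M).toLinearMap ∘ₗ LinearMap.lTensor M κ

@[simp]
theorem contractWith_tmul (κ : Module.Dual ℂ K) (m : M) (k : K) :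
    contractWith M κ (m ⊗ₜ k) = κ k • m := by
  simp [contractWith]

theorem contractWith_rTensor (κ : Module.Dual ℂ K) (f : M →ₗ[ℂ] N) (z : M ⊗[ℂ] K) :
    contractWith N κ (LinearMap.rTensor K f z) = f (contractWith M κ z) := by
  induction z with
  | zero => simp
  | tmul m k => simp
  | add a b ha hb => simp only [map_add, ha, hb]

/-- Functionals on the second factor detect vanishing in a tensor product. -/
theorem eq_zero_of_contractWith (z : M ⊗[ℂ] K)
    (h : ∀ κ : Module.Dual ℂ K, contractWith M κ z = 0) : z = 0 := by
  classical
  let b := Module.Free.chooseBasis ℂ K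
  have key : ∀ (w : M ⊗[ℂ] K) i,
      TensorProduct.equivFinsuppOfBasisRight b w i = contractWith M (b.coord i) w := by
    intro w i
    induction w with
    | zero => simp
    | tmul m k => simp
    | add a c ha hc => simp only [map_add, Finsupp.add_apply, ha, hc]
  apply (TensorProduct.equivFinsuppOfBasisRight b).injective
  ext i
  rw [key, h]
  simp

/-- In a line, `λ(a) b = λ(b) a`. -/
theorem dual_smul_comm (hL : Module.finrank ℂ L = 1) (l : Module.Dual ℂ L) (a b : L) :
    l a • b = l b • a := by
  obtain ⟨v, hv, h⟩ := finrank_eq_one_iff'.1 hL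
  obtain ⟨r, rfl⟩ := h a
  obtain ⟨s, rfl⟩ := h b
  simp only [map_smul, smul_smul, smul_eq_mul]
  ring_nf

/-- If `∑ λⱼ(v) lⱼ = v` for all `v` in a line, then `∑ lⱼ ⊗ λⱼ` is the canonical element
of `L ⊗ L^*`. -/
theorem lineContract_symm_one (hL : Module.finrank ℂ L = 1) {J : Type*} [Fintype J]
    (l : J → L) (c : J → Module.Dual ℂ L) (h : ∀ v, ∑ j, c j v • l j = v) :
    (lineContract hL).symm 1 = ∑ j, l j ⊗ₜ c j := by
  rw [LinearEquiv.symm_apply_eq]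
  obtain ⟨v, hv, -⟩ := finrank_eq_one_iff'.1 hL
  have h1 : (lineContract hL) (∑ j, l j ⊗ₜ c j) = ∑ j, c j (l j) := by
    simp [lineContract]
  -- Two scalars agree once they act alike on the nonzero `v`; moving `v` inside the functionals by
  -- `dual_smul_comm` recovers the hypothesis.
  have h2 : (∑ j, c j (l j)) • v = (1 : ℂ) • v := by
    rw [Finset.sum_smul, one_smul]
    conv_rhs => rw [← h v]
    exact Finset.sum_congr rfl fun j _ => dual_smul_comm hL _ _ _
  rw [h1]
  exact (smul_left_injective ℂ hv h2).symm

/-- The image under `endEquiv` of an endomorphism of rank one. -/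
theorem endEquiv_dualTensorHom [FiniteDimensional ℂ V] (hL : Module.finrank ℂ L = 1)
    (e : V ≃ₗ[ℂ] Module.Dual ℂ V ⊗[ℂ] L) {J : Type*} [Fintype J]
    (l : J → L) (c : J → Module.Dual ℂ L) (h : ∀ v, ∑ j, c j v • l j = v)
    (f : Module.Dual ℂ V) (w : V) :
    endEquiv hL e (dualTensorHom ℂ V V (f ⊗ₜ w)) =
      ∑ j, (w ⊗ₜ e.symm (f ⊗ₜ l j)) ⊗ₜ c j := by
  have h0 : (dualTensorHomEquiv ℂ V V).symm (dualTensorHom ℂ V V (f ⊗ₜ w)) = f ⊗ₜ w := by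
    rw [LinearEquiv.symm_apply_eq]
    rfl
  simp only [endEquiv, LinearEquiv.trans_apply, h0]
  simp [lineContract_symm_one hL l c h, TensorProduct.tmul_sum]

theorem dualTensorHom_hat [FiniteDimensional ℂ V] (φ : V ⊗[ℂ] V →ₗ[ℂ] L) (u v : V) :
    dualTensorHom ℂ V L (hat φ u) v = φ (u ⊗ₜ v) := by
  have : dualTensorHomEquiv ℂ V L (hat φ u) = TensorProduct.curry φ u := by
    simp [hat]
  exact LinearMap.congr_fun this v

/-- The pairing `(u, v) ↦ λ(φ(h, u)) φ(w, v)` attached to `w ⊗ h ⊗ λ`. -/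
noncomputable def tensorPairing (φ : V ⊗[ℂ] V →ₗ[ℂ] L) (u v : V) :
    (V ⊗[ℂ] V) ⊗[ℂ] Module.Dual ℂ L →ₗ[ℂ] L :=
  TensorProduct.lift <| TensorProduct.lift <| LinearMap.mk₂ ℂ
    (fun w h => (LinearMap.applyₗ (φ (h ⊗ₜ u))).smulRight (φ (w ⊗ₜ v)))
    (fun _ _ _ => by ext; simp [TensorProduct.add_tmul])
    (fun c w h => by
      ext l
      simp only [LinearMap.smulRight_apply, LinearMap.smul_apply, ← TensorProduct.smul_tmul',
        map_smul]
      rw [smul_comm])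
    (fun _ _ _ => by ext; simp [TensorProduct.add_tmul, add_smul])
    (fun c w h => by
      ext l
      simp only [LinearMap.smulRight_apply, LinearMap.smul_apply, ← TensorProduct.smul_tmul',
        map_smul, LinearMap.applyₗ_apply_apply, smul_assoc])

@[simp]
theorem tensorPairing_tmul (φ : V ⊗[ℂ] V →ₗ[ℂ] L) (u v w h : V) (l : Module.Dual ℂ L) :
    tensorPairing φ u v ((w ⊗ₜ h) ⊗ₜ l) = l (φ (h ⊗ₜ u)) • φ (w ⊗ₜ v) := by
  simp [tensorPairing]

/-- The exchange of the first two factors of `V ⊗ V ⊗ L^*`. -/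
noncomputable abbrev exchange (V L : Type*) [AddCommGroup V] [Module ℂ V] [AddCommGroup L]
    [Module ℂ L] :
    (V ⊗[ℂ] V) ⊗[ℂ] Module.Dual ℂ L →ₗ[ℂ] (V ⊗[ℂ] V) ⊗[ℂ] Module.Dual ℂ L :=
  LinearMap.rTensor (Module.Dual ℂ L) (TensorProduct.comm ℂ V V).toLinearMap

/-- On `w ⊗ h ⊗ λ` the two sides are `λ(φ(w, u)) φ(h, v)` and `λ(φ(h, v)) φ(w, u)`, which agree
because `L` is a line. No symmetry of `φ` enters. -/
theorem tensorPairing_exchange (hL : Module.finrank ℂ L = 1) (φ : V ⊗[ℂ] V →ₗ[ℂ] L) (u v : V)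
    (T : (V ⊗[ℂ] V) ⊗[ℂ] Module.Dual ℂ L) :
    tensorPairing φ u v (exchange V L T) = tensorPairing φ v u T := by
  induction T with
  | zero => simp
  | add a b ha hb => simp only [map_add, ha, hb]
  | tmul s l =>
    induction s with
    | zero => simp
    | add a b ha hb => simp only [TensorProduct.add_tmul, map_add, ha, hb]
    | tmul w h => simpa using dual_smul_comm hL l _ _

/-- By linearity take `A = f ⊗ w`. Its tensor is `∑ w ⊗ hⱼ ⊗ λⱼ`, where `hⱼ` represents `f ⊗ lⱼ`, so
`φ(hⱼ, u) = f(u) lⱼ`; summing `λⱼ(lⱼ)` over a basis of the line gives `1`, which leaves `f(u) φ(w,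
v)`. -/
theorem tensorPairing_endEquiv [FiniteDimensional ℂ V] (hL : Module.finrank ℂ L = 1)
    (φ : V ⊗[ℂ] V →ₗ[ℂ] L) (hφ : Function.Bijective (hat φ)) (A : Module.End ℂ V) (u v : V) :
    tensorPairing φ u v (endEquiv hL (LinearEquiv.ofBijective (hat φ) hφ) A) =
      φ (A u ⊗ₜ v) := by
  obtain ⟨z, rfl⟩ := (dualTensorHomEquiv ℂ V V).surjective A
  change tensorPairing φ u v (endEquiv hL _ (dualTensorHom ℂ V V z)) =
    φ (dualTensorHom ℂ V V z u ⊗ₜ v)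
  induction z with
  | zero => simp
  | add a b ha hb => simp only [map_add, ha, hb, LinearMap.add_apply, TensorProduct.add_tmul]
  | tmul f w =>
    have : FiniteDimensional ℂ L := Module.finite_of_finrank_eq_succ hL
    let b := Module.finBasis ℂ L
    have hb : ∀ v, ∑ j, b.coord j v • b j = v := fun v => by simp
    rw [endEquiv_dualTensorHom hL _ b b.coord hb]
    have hφ' : ∀ j, φ ((LinearEquiv.ofBijective (hat φ) hφ).symm (f ⊗ₜ b j) ⊗ₜ u) =
        f u • b j := by
      intro j
      rw [← dualTensorHom_hat]
      have := (LinearEquiv.ofBijective (hat φ) hφ).apply_symm_apply (f ⊗ₜ b j)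
      rw [LinearEquiv.ofBijective_apply] at this
      rw [this, dualTensorHom_apply]
    simp only [map_sum, tensorPairing_tmul, hφ', dualTensorHom_apply]
    conv_rhs => rw [← TensorProduct.smul_tmul', map_smul, ← hb (φ (w ⊗ₜ v)), Finset.smul_sum]
    refine Finset.sum_congr rfl fun j _ => ?_
    rw [map_smul, smul_assoc, dual_smul_comm hL]

/-- Nondegeneracy: the pairings `tensorPairing φ u v` separate tensors. -/
theorem eq_zero_of_tensorPairing [FiniteDimensional ℂ V] (hL : Module.finrank ℂ L = 1)
    (φ : V ⊗[ℂ] V →ₗ[ℂ] L) (hφ : Function.Bijective (hat φ))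
    (T : (V ⊗[ℂ] V) ⊗[ℂ] Module.Dual ℂ L) (h : ∀ u v, tensorPairing φ u v T = 0) : T = 0 := by
  -- Every tensor comes from some `A`; the hypothesis then reads `φ(Au, v) = 0` for all `u`, `v`,
  -- and injectivity of the adjoint gives `A = 0`.
  obtain ⟨A, rfl⟩ := (endEquiv hL (LinearEquiv.ofBijective (hat φ) hφ)).surjective T
  suffices hA : A = 0 by rw [hA, map_zero]
  ext u
  apply hφ.1
  apply (dualTensorHomEquiv ℂ V L).injective
  ext v
  change dualTensorHom ℂ V L _ v = dualTensorHom ℂ V L _ v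
  rw [dualTensorHom_hat, dualTensorHom_hat, ← tensorPairing_endEquiv hL φ hφ A u v, h]
  simp

/-- For a `-δ`-symmetric perfect pairing `φ` (`δ = ±1`), the infinitesimal invariance of `φ` under
`θ ∈ End V ⊗ K` means that the tensor in `V ⊗ V ⊗ L^* ⊗ K` attached to `θ` is `δ`-symmetric. -/
theorem compatible_iff_exchange [FiniteDimensional ℂ V] (hL : Module.finrank ℂ L = 1)
    (φ : V ⊗[ℂ] V →ₗ[ℂ] L) (hφ : Function.Bijective (hat φ)) (δ : ℂ) (hδ : δ * δ = 1)
    (hs : ∀ u v, φ (u ⊗ₜ v) = -δ • φ (v ⊗ₜ u)) (θ : Module.End ℂ V ⊗[ℂ] K) :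
    (∀ u v, pairLeft φ (higgsApply θ u) v + pairRight φ u (higgsApply θ v) = 0) ↔
      LinearMap.rTensor K (exchange V L) (LinearMap.rTensor K
        (endEquiv hL (LinearEquiv.ofBijective (hat φ) hφ)).toLinearMap θ) =
      δ • LinearMap.rTensor K
        (endEquiv hL (LinearEquiv.ofBijective (hat φ) hφ)).toLinearMap θ := by
  set e := endEquiv hL (LinearEquiv.ofBijective (hat φ) hφ) with he
  -- Contraction with `κ` replaces `θ` by an endomorphism `A`. The second term becomes `φ(u, Av) =
  -- -δ φ(Av, u)`, the pairing of the exchanged tensor up to the factor `-δ`.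
  have hc : ∀ (κ : Module.Dual ℂ K) u v,
      contractWith L κ (pairLeft φ (higgsApply θ u) v + pairRight φ u (higgsApply θ v)) =
        tensorPairing φ u v (e (contractWith _ κ θ) -
          δ • exchange V L (e (contractWith _ κ θ))) := by
    intro κ u v
    rw [map_add, pairLeft, pairRight, higgsApply, higgsApply, contractWith_rTensor,
      contractWith_rTensor, contractWith_rTensor, contractWith_rTensor, map_sub, map_smul,
      tensorPairing_exchange hL, he, tensorPairing_endEquiv, tensorPairing_endEquiv]
    simp only [LinearMap.flip_apply, TensorProduct.curry_apply, LinearMap.applyₗ_apply_apply]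
    rw [hs u, neg_smul, sub_eq_add_neg]
  have hk : ∀ κ : Module.Dual ℂ K,
      contractWith _ κ (LinearMap.rTensor K e.toLinearMap θ -
        δ • LinearMap.rTensor K (exchange V L) (LinearMap.rTensor K e.toLinearMap θ)) =
      e (contractWith _ κ θ) - δ • exchange V L (e (contractWith _ κ θ)) := by
    intro κ
    rw [map_sub, map_smul, contractWith_rTensor, contractWith_rTensor,
      contractWith_rTensor, LinearEquiv.coe_coe]
  constructor
  · intro h
    have h0 := eq_zero_of_contractWith _ fun κ => (hk κ).trans <|
      eq_zero_of_tensorPairing hL φ hφ _ fun u v => by rw [← hc, h, map_zero]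
    -- This gives the tensor as `δ` times its exchange; multiplying by `δ` and using `δ² = 1` gives
    -- the stated form.
    rw [sub_eq_zero] at h0
    conv_rhs => rw [h0, smul_smul, hδ, one_smul]
  · intro h u v
    refine eq_zero_of_contractWith _ fun κ => ?_
    rw [hc, ← hk, h, smul_smul, hδ, one_smul, sub_self, map_zero, map_zero]

/-- A finite filtration `f 0 ⊇ f 1 ⊇ ⋯ ⊇ f n = 0` admits finitely many vectors `bᵢ ∈ f (jᵢ)` and
functionals `cᵢ` vanishing on `f (jᵢ + 1)`, with `∑ cᵢ(v) bᵢ = v` on `f 0`. -/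
theorem exists_adapted_frame [FiniteDimensional ℂ V] (n : ℕ) (f : ℕ → Submodule ℂ V)
    (hf : Antitone f) (hn : f n = ⊥) :
    ∃ (k : ℕ) (b : Fin k → V) (c : Fin k → Module.Dual ℂ V) (j : Fin k → ℕ),
      (∀ i, j i < n ∧ b i ∈ f (j i) ∧ ∀ v ∈ f (j i + 1), c i v = 0) ∧
      ∀ v ∈ f 0, ∑ i, c i v • b i = v := by
  induction n generalizing f with
  | zero =>
    refine ⟨0, Fin.elim0, Fin.elim0, Fin.elim0, fun i => i.elim0, fun v hv => ?_⟩
    rw [hn, Submodule.mem_bot] at hv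
    simp [hv]
  | succ n ih =>
    obtain ⟨k, b, c, j, h, hsum⟩ := ih (fun i => f (i + 1))
      (fun a b hab => hf (Nat.succ_le_succ hab)) hn
    obtain ⟨q, hq⟩ := (f 1).subtype.exists_leftInverse_of_injective (by simp)
    obtain ⟨r, hr⟩ := (f 0).subtype.exists_leftInverse_of_injective (by simp)
    have hq' : ∀ v (hv : v ∈ f 1), ((q v : f 1) : V) = v := fun v hv => by
      simpa using congrArg Subtype.val (LinearMap.congr_fun hq ⟨v, hv⟩)
    have hr' : ∀ v (hv : v ∈ f 0), ((r v : f 0) : V) = v := fun v hv => by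
      simpa using congrArg Subtype.val (LinearMap.congr_fun hr ⟨v, hv⟩)
    -- A basis of all of `f 0` replaces a basis of a complement of `f 1`: the family may be
    -- redundant, since only `∑ cᵢ(v) bᵢ = v` is required. With `p` a projection onto `f 1`, the old
    -- functionals see `p v` and the new ones `v - p v`, so the new ones vanish on `f 1`.
    let β := Module.finBasis ℂ (f 0)
    let p : V →ₗ[ℂ] V := (f 1).subtype ∘ₗ q
    refine ⟨k + Module.finrank ℂ (f 0), Fin.append b (fun i => (β i : V)),
      Fin.append (fun i => c i ∘ₗ p) (fun i => β.coord i ∘ₗ r ∘ₗ (LinearMap.id - p)),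
      Fin.append (fun i => j i + 1) (fun _ => 0), fun i => ?_, fun v hv => ?_⟩
    · refine Fin.addCases (fun i => ?_) (fun i => ?_) i
      · simp only [Fin.append_left]
        refine ⟨by have := (h i).1; omega, (h i).2.1, fun v hv => ?_⟩
        have : p v = v := hq' v (hf (by omega) hv)
        rw [LinearMap.comp_apply, this]
        exact (h i).2.2 v hv
      · simp only [Fin.append_right]
        refine ⟨by omega, (β i).2, fun v hv => ?_⟩
        have : p v = v := hq' v hv
        simp [this]
    · rw [Fin.sum_univ_add]
      simp only [Fin.append_left, Fin.append_right, LinearMap.comp_apply]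
      rw [hsum (p v) (q v).2]
      have h1 : v - p v ∈ f 0 := sub_mem hv (hf (Nat.zero_le 1) (q v).2)
      have h2 : ∑ i, β.coord i (r (v - p v)) • (β i : V) = v - p v := by
        conv_rhs => rw [← hr' _ h1, ← β.sum_repr (r (v - p v))]
        simp
      simp only [LinearMap.sub_apply, LinearMap.id_apply] at h2 ⊢
      rw [h2]
      abel

end LinearAlgebra

/-! ### Holomorphic sections and local frames -/

section LocalFrames

variable {X : Type*} [TopologicalSpace X] (F : Type*) [NormedAddCommGroup F] [NormedSpace ℂ F]
  {E : X → Type*} [TopologicalSpace (TotalSpace F E)]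
  [∀ x, TopologicalSpace (E x)] [FiberBundle F E]
  [∀ x, AddCommGroup (E x)] [∀ x, Module ℂ (E x)] [VectorBundle ℂ F E]

/-- The section through `v ∈ E y` that is constant in the preferred trivialization at `y`. -/
noncomputable def constSection (y : X) (v : E y) (x : X) : E x :=
  (trivializationAt F E y).symmₗ ℂ x ((trivializationAt F E y).linearMapAt ℂ y v)

/-- The functional on the fibres extending `c : E y → ℂ` that is constant in the preferred
trivialization at `y`. -/
noncomputable def constFunctional (y : X) (c : Module.Dual ℂ (E y)) (x : X) :
    Module.Dual ℂ (E x) :=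
  c ∘ₗ (trivializationAt F E y).symmₗ ℂ y ∘ₗ (trivializationAt F E y).linearMapAt ℂ x

theorem constSection_self (y : X) (v : E y) : constSection F y v y = v :=
  Trivialization.symmₗ_linearMapAt _ (mem_baseSet_trivializationAt F E y) v

theorem constFunctional_self (y : X) (c : Module.Dual ℂ (E y)) (v : E y) :
    constFunctional F y c y v = c v :=
  congrArg c (Trivialization.symmₗ_linearMapAt _ (mem_baseSet_trivializationAt F E y) v)

/-- In the trivialization at `y` vectors and functionals are both constant, so the identity in the
fibre at `y` transports to every fibre over the base set. -/
theorem sum_constFunctional_smul_constSection {ι : Type*} [Fintype ι] (y : X) (b : ι → E y)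
    (c : ι → Module.Dual ℂ (E y)) (h : ∀ v, ∑ i, c i v • b i = v) {x : X}
    (hx : x ∈ (trivializationAt F E y).baseSet) (v : E x) :
    ∑ i, constFunctional F y (c i) x v • constSection F y (b i) x = v := by
  simp only [constFunctional, constSection, LinearMap.comp_apply, ← map_smul, ← map_sum, h]
  rw [Trivialization.linearMapAt_symmₗ _ (mem_baseSet_trivializationAt F E y),
    Trivialization.symmₗ_linearMapAt _ hx]

end LocalFrames

section Sections

variable {X : Type*} [TopologicalSpace X] [ChartedSpace ℂ X]

theorem holAt_trivial_iff {g : X → ℂ} {y : X} :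
    HolAt (E := Bundle.Trivial X ℂ) ℂ g y ↔ ContMDiffAt 𝓘(ℂ, ℂ) 𝓘(ℂ, ℂ) ω g y :=
  contMDiffAt_section (E := Bundle.Trivial X ℂ) y

/-- A holomorphic function vanishing at `y` is divisible by the local coordinate at `y`. -/
theorem exists_eq_coord_mul [IsManifold 𝓘(ℂ, ℂ) ω X] {g : X → ℂ} {y : X}
    (hg : ContMDiffAt 𝓘(ℂ, ℂ) 𝓘(ℂ, ℂ) ω g y) (h0 : g y = 0) :
    ∃ k : X → ℂ, ContMDiffAt 𝓘(ℂ, ℂ) 𝓘(ℂ, ℂ) ω k y ∧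
      ∀ᶠ x in 𝓝 y, g x = (chartAt ℂ y x - chartAt ℂ y y) * k x := by
  set z := chartAt ℂ y with hz
  have hy : y ∈ z.source := mem_chart_source ℂ y
  have hs : ContMDiffAt 𝓘(ℂ, ℂ) 𝓘(ℂ, ℂ) ω z.symm (z y) :=
    (contMDiffOn_chart_symm (I := 𝓘(ℂ, ℂ)) (x := y)).contMDiffAt
      (z.open_target.mem_nhds (z.map_source hy))
  have hG : ContMDiffAt 𝓘(ℂ, ℂ) 𝓘(ℂ, ℂ) ω (g ∘ z.symm) (z y) :=
    ContMDiffAt.comp (z y) (by rwa [z.left_inv hy]) hs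
  have hA : AnalyticAt ℂ (g ∘ z.symm) (z y) :=
    (contMDiffAt_iff_contDiffAt.1 hG).analyticAt
  obtain ⟨p, hp⟩ := hA
  -- The quotient by the coordinate is `dslope` read in the chart; its power series is that of `g`
  -- shifted by one degree.
  have hd : AnalyticAt ℂ (dslope (g ∘ z.symm) (z y)) (z y) :=
    ⟨_, hp.has_fpower_series_dslope_fslope⟩
  refine ⟨dslope (g ∘ z.symm) (z y) ∘ z, ?_, ?_⟩
  · refine ContMDiffAt.comp y (contMDiffAt_iff_contDiffAt.2 hd.contDiffAt) ?_
    exact (contMDiffOn_chart (I := 𝓘(ℂ, ℂ)) (x := y)).contMDiffAt (z.open_source.mem_nhds hy)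
  · filter_upwards [z.open_source.mem_nhds hy] with x hx
    have := sub_smul_dslope (g ∘ z.symm) (z y) (z x)
    simp only [Function.comp_apply, z.left_inv hx, z.left_inv hy, h0, sub_zero,
      smul_eq_mul] at this ⊢
    exact this.symm

variable (F : Type*) [NormedAddCommGroup F] [NormedSpace ℂ F]
  {E : X → Type*} [TopologicalSpace (TotalSpace F E)]
  [∀ x, TopologicalSpace (E x)] [FiberBundle F E]
  [∀ x, AddCommGroup (E x)] [∀ x, Module ℂ (E x)] [VectorBundle ℂ F E]

theorem HolAt.const_smul {F} [NormedAddCommGroup F] [NormedSpace ℂ F]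
    [TopologicalSpace (TotalSpace F E)] [FiberBundle F E] [VectorBundle ℂ F E]
    {g : ∀ x, E x} {y : X} (hg : HolAt F g y) (a : ℂ) : HolAt F (fun x => a • g x) y :=
  ContMDiffAt.const_smul_section hg

variable [ContMDiffVectorBundle ω F E 𝓘(ℂ, ℂ)]

theorem holAt_constSection (y : X) (v : E y) {x : X}
    (hx : x ∈ (trivializationAt F E y).baseSet) : HolAt F (constSection F y v) x := by
  rw [HolAt, Trivialization.contMDiffAt_section_iff (trivializationAt F E y) hx]
  refine (contMDiffAt_const (c := (trivializationAt F E y).linearMapAt ℂ y v)).congr_of_eventuallyEq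
    ?_
  filter_upwards [(trivializationAt F E y).open_baseSet.mem_nhds hx] with x' hx'
  have := (trivializationAt F E y).linearMapAt_symmₗ (R := ℂ) hx'
    ((trivializationAt F E y).linearMapAt ℂ y v)
  rwa [Trivialization.coe_linearMapAt_of_mem _ hx'] at this

/-- In the trivialization the functional is one fixed linear form on `F`, which is continuous, hence
holomorphic, because `F` is finite-dimensional. -/
theorem contMDiffAt_constFunctional (y : X) [FiniteDimensional ℂ (E y)]
    (c : Module.Dual ℂ (E y)) {x : X}
    (hx : x ∈ (trivializationAt F E y).baseSet) {g : ∀ x, E x} (hg : HolAt F g x) :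
    ContMDiffAt 𝓘(ℂ, ℂ) 𝓘(ℂ, ℂ) ω (fun x => constFunctional F y c x (g x)) x := by
  have : FiniteDimensional ℂ F := ((trivializationAt F E y).linearEquivAt ℂ y
    (mem_baseSet_trivializationAt F E y)).finiteDimensional
  let l : F →L[ℂ] ℂ := (c ∘ₗ (trivializationAt F E y).symmₗ ℂ y).toContinuousLinearMap
  rw [HolAt, Trivialization.contMDiffAt_section_iff (trivializationAt F E y) hx] at hg
  refine (ContMDiffAt.comp x l.contDiff.contMDiff.contMDiffAt hg).congr_of_eventuallyEq ?_
  filter_upwards [(trivializationAt F E y).open_baseSet.mem_nhds hx] with x' hx'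
  simp only [constFunctional, LinearMap.comp_apply, Trivialization.coe_linearMapAt_of_mem _ hx']
  rfl

end Sections

/-! ### Sections of parabolic bundles -/

/-- Vectors and functionals in the fibre over a marked point that are adapted to the weights. -/
theorem ParabolicStructure.exists_weighted_frame {X : Type*} {D : Finset X} {E : X → Type*}
    [∀ x, AddCommGroup (E x)] [∀ x, Module ℂ (E x)] [∀ x, FiniteDimensional ℂ (E x)]
    (P : ParabolicStructure D E) (p : D) :
    ∃ (k : ℕ) (b : Fin k → E p.1) (c : Fin k → Module.Dual ℂ (E p.1)) (a : Fin k → ℝ),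
      (∀ i, 0 ≤ a i ∧ a i < 1 ∧ b i ∈ P.flagAt p (a i) ∧
        ∀ τ, a i < τ → ∀ v ∈ P.flagAt p τ, c i v = 0) ∧
      ∀ v, ∑ i, c i v • b i = v := by
  -- The flag is continued by its last member, which is zero, to all natural indices; the `min`
  -- keeps `Fin.ofNat` from wrapping around.
  let f : ℕ → Submodule ℂ (E p.1) := fun j => P.flag p (Fin.ofNat (P.len p + 1) (min j (P.len p)))
  have hf' : ∀ j (hj : j < P.len p + 1), f j = P.flag p ⟨j, hj⟩ := by
    intro j hj
    simp only [f]
    congr 1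
    ext
    simp only [Fin.ofNat]
    rw [min_eq_left (by omega), Nat.mod_eq_of_lt hj]
  have hf : Antitone f := by
    intro i j hij
    refine (P.flag_strictAnti p).antitone ?_
    rw [Fin.le_def]
    simp only [Fin.ofNat]
    rw [Nat.mod_eq_of_lt (by omega), Nat.mod_eq_of_lt (by omega)]
    exact min_le_min_right _ hij
  obtain ⟨k, b, c, j, h, hsum⟩ := exists_adapted_frame (P.len p) f hf
    (by rw [hf' _ (Nat.lt_succ_self _)]; exact P.flag_last p)
  refine ⟨k, b, c, fun i => P.weight p ⟨j i, (h i).1⟩, fun i => ⟨P.weight_nonneg p _,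
    P.weight_lt_one p _, ?_, fun τ hτ v hv => ?_⟩, fun v => hsum v ?_⟩
  · have hb := (h i).2.1
    rw [hf' _ (Nat.lt_succ_of_lt (h i).1)] at hb
    exact le_iSup₂_of_le (f := fun l (_ : P.weight p ⟨j i, (h i).1⟩ ≤ P.weight p l) =>
      P.flag p l.castSucc) ⟨j i, (h i).1⟩ le_rfl le_rfl hb
  · have : P.flagAt p τ ≤ LinearMap.ker (c i) := by
      refine iSup₂_le fun l hl w hw => (h i).2.2 w ?_
      -- Weights increase strictly, so a flag member of weight at least `τ > aᵢ` lies strictly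
      -- deeper than step `j i`, where `c i` vanishes.
      have hlt : j i < l := (P.weight_strictMono p).lt_iff_lt.1 (hτ.trans_le hl)
      refine hf (Nat.succ_le_of_lt hlt) ?_
      rw [hf' _ (by omega)]
      exact hw
    exact this hv
  · rw [hf' 0 (Nat.succ_pos _)]
    exact (P.flag_zero p).ge trivial

section Parabolic

variable {X : Type*} [TopologicalSpace X] [ChartedSpace ℂ X] {D : Finset X}
  {F : Type*} [NormedAddCommGroup F] [NormedSpace ℂ F]
  {E : X → Type*} [TopologicalSpace (TotalSpace F E)]
  [∀ x, TopologicalSpace (E x)] [FiberBundle F E]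
  [∀ x, AddCommGroup (E x)] [∀ x, Module ℂ (E x)]

theorem GermAt.map {y : X} {m : ℤ} {S : Submodule ℂ (E y)} {s : ∀ x : Cpl D, E x.1}
    (h : GermAt F y m S s) (A : ∀ x, E x →ₗ[ℂ] E x)
    (hA : ∀ g : ∀ x, E x, HolAt F g y → HolAt F (fun x => A x (g x)) y)
    (hS : ∀ v ∈ S, A y v ∈ S) : GermAt F y m S (fun x => A x.1 (s x)) := by
  obtain ⟨g, hg, hgS, hs⟩ := h
  refine ⟨_, hA g hg, hS _ hgS, hs.mono fun x hx hD => ?_⟩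
  simp only [hx hD, map_smul]

/-- Since `flagAt` is a supremum of flag members, preserving the flag preserves the condition on
leading coefficients. -/
theorem ParabolicStructure.filtered_map (P : ParabolicStructure D E) {U : Opens X} {t : ℝ}
    {s : ∀ x : Cpl D, E x.1} (hs : s ∈ P.filtered F t U) (A : ∀ x, E x →ₗ[ℂ] E x)
    (hA : ∀ y ∈ U, ∀ g : ∀ x, E x, HolAt F g y → HolAt F (fun x => A x (g x)) y)
    (hS : ∀ p : D, p.1 ∈ U → ∀ j, ∀ v ∈ P.flag p j, A p.1 v ∈ P.flag p j) :
    (fun x : Cpl D => A x.1 (s x)) ∈ P.filtered F t U := by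
  refine fun y hy => ⟨fun hD => ((hs y hy).1 hD).map A (hA y hy) (by simp),
    fun hD => ((hs y hy).2 hD).map A (hA y hy) ?_⟩
  have : P.flagAt ⟨y, hD⟩ (Int.fract t) ≤ (P.flagAt ⟨y, hD⟩ (Int.fract t)).comap (A y) := by
    refine iSup₂_le fun j hj v hv => ?_
    exact le_iSup₂_of_le (f := fun j (_ : Int.fract t ≤ P.weight ⟨y, hD⟩ j) =>
      P.flag ⟨y, hD⟩ j.castSucc) j hj le_rfl (hS ⟨y, hD⟩ hy _ v hv)
  exact this

theorem ParabolicStructure.IsAdP.filtered_map {P : ParabolicStructure D E} {U : Opens X}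
    {A : ∀ x, Module.End ℂ (E x)} (hA : P.IsAdP F U A) {N : Opens X} (hN : N ≤ U) {t : ℝ}
    {s : ∀ x : Cpl D, E x.1} (hs : s ∈ P.filtered F t N) :
    (fun x : Cpl D => A x.1 (s x)) ∈ P.filtered F t N :=
  P.filtered_map hs A (fun y hy => hA.1 y (hN hy)) fun p hp => hA.2.2 p (hN hp)

theorem ParabolicStructure.filtered_smul [VectorBundle ℂ F E] (P : ParabolicStructure D E)
    {U : Opens X} {t : ℝ} {s : ∀ x : Cpl D, E x.1} (hs : s ∈ P.filtered F t U) (a : ℂ) :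
    (fun x => a • s x) ∈ P.filtered F t U :=
  P.filtered_map hs (fun _ => a • LinearMap.id) (fun _ _ _ hg => hg.const_smul a)
    fun _ _ _ _ hv => Submodule.smul_mem _ a hv

variable [∀ x, FiniteDimensional ℂ (E x)]

/-- Near every point there are finitely many sections `eᵢ` of `E_{aᵢ}` and `cᵢ` of `(E^*)_{-aᵢ}`
with `∑ eᵢ ⊗ cᵢ = id`. -/
theorem ParabolicStructure.exists_local_frame [T1Space X] [IsManifold 𝓘(ℂ, ℂ) ω X]
    [VectorBundle ℂ F E] [ContMDiffVectorBundle ω F E 𝓘(ℂ, ℂ)] (P : ParabolicStructure D E)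
    (y : X) :
    ∃ N : Opens X, y ∈ N ∧ ∃ (k : ℕ) (a : Fin k → ℝ) (e : Fin k → ∀ x, E x)
      (c : Fin k → ∀ x, Module.Dual ℂ (E x)), ∀ N' ≤ N,
      (∀ i, (fun x : Cpl D => e i x.1) ∈ P.filtered F (a i) N' ∧
        (fun x : Cpl D => c i x.1) ∈ dual (P.filtered F) (-a i) N') ∧
      ∀ x ∈ N', ∀ v : E x, ∑ i, c i x v • e i x = v := by
  classical
  obtain ⟨k, b, c, a, h, hsum⟩ : ∃ (k : ℕ) (b : Fin k → E y) (c : Fin k → Module.Dual ℂ (E y))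
      (a : Fin k → ℝ), (∀ hy : y ∈ D, ∀ i, 0 ≤ a i ∧ a i < 1 ∧ b i ∈ P.flagAt ⟨y, hy⟩ (a i) ∧
        ∀ τ, a i < τ → ∀ v ∈ P.flagAt ⟨y, hy⟩ τ, c i v = 0) ∧
      ∀ v, ∑ i, c i v • b i = v := by
    by_cases hy : y ∈ D
    · obtain ⟨k, b, c, a, h, hsum⟩ := P.exists_weighted_frame ⟨y, hy⟩
      exact ⟨k, b, c, a, fun _ => h, hsum⟩
    -- Off `D` the weights are unconstrained, so any basis with all weights `0` serves.
    · let β := Module.finBasis ℂ (E y)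
      exact ⟨_, β, β.coord, 0, fun h => absurd h hy, fun v => by simp⟩
  -- Removing the other marked points leaves `y` as the only possible point of `D` in `N`.
  let N : Opens X := ⟨(trivializationAt F E y).baseSet ∩ (↑(D.erase y) : Set X)ᶜ,
    (trivializationAt F E y).open_baseSet.inter (D.erase y).finite_toSet.isClosed.isOpen_compl⟩
  have hND : ∀ x ∈ N, x ∈ D → x = y := by
    intro x hx hxD
    by_contra hne
    exact hx.2 (by simp [hne, hxD])
  refine ⟨N, ⟨mem_baseSet_trivializationAt F E y, by simp⟩, k, a,
    fun i => constSection F y (b i), fun i => constFunctional F y (c i), fun N' hN =>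
    ⟨fun i => ⟨fun x hx => ⟨fun _ => ?_, fun hxD => ?_⟩, ?_⟩, fun x hx v => ?_⟩⟩
  · exact ⟨_, holAt_constSection F y (b i) (hN hx).1, trivial, by simp⟩
  · obtain rfl := hND x (hN hx) hxD
    obtain ⟨h0, h1, hb, -⟩ := h hxD i
    have hfl : ⌊a i⌋ = 0 := Int.floor_eq_zero_iff.2 ⟨h0, h1⟩
    rw [Int.fract_eq_self.2 ⟨h0, h1⟩, hfl]
    exact ⟨_, holAt_constSection F x (b i) (hN hx).1, by rwa [constSection_self], by simp⟩
  · intro M hM t s hs x hx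
    have hxN : x ∈ N := hN (hM hx)
    refine ⟨fun hxD => ?_, fun hxD => ?_⟩
    · obtain ⟨g, hg, -, hsg⟩ := (hs x hx).1 hxD
      refine ⟨_, holAt_trivial_iff.2 (contMDiffAt_constFunctional F y (c i) hxN.1 hg), trivial,
        hsg.mono fun x' hx' hD => ?_⟩
      simp [hx' hD]
    · obtain rfl := hND x hxN hxD
      obtain ⟨g, hg, hgS, hsg⟩ := (hs x hx).2 hxD
      obtain ⟨h0, h1, -, hc⟩ := h hxD i
      have hcg := contMDiffAt_constFunctional F x (c i) hxN.1 hg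
      have hf0 := Int.fract_nonneg t
      have hf1 := Int.fract_lt_one t
      have hft := Int.floor_add_fract t
      -- The value of `cᵢ` on `E_t` must vanish to order `⌈t - aᵢ⌉`. If `fract t ≤ aᵢ` this is
      -- `⌊t⌋`, already the order of the section. Otherwise one more order is needed, and it is
      -- there because `cᵢ` kills the leading coefficient.
      rcases le_or_gt (Int.fract t) (a i) with hle | hlt
      · have hceil : ⌈t + -a i⌉ = ⌊t⌋ := by
          rw [Int.ceil_eq_iff]
          constructor <;> linarith
        rw [hceil, sub_zero]
        refine ⟨_, holAt_trivial_iff.2 hcg, trivial, hsg.mono fun x' hx' hD => ?_⟩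
        simp only [hx' hD, map_smul]
      · have hceil : ⌈t + -a i⌉ = ⌊t⌋ + 1 := by
          rw [Int.ceil_eq_iff]
          push_cast
          constructor <;> linarith
        rw [hceil, sub_zero]
        obtain ⟨q, hq, hgq⟩ := exists_eq_coord_mul hcg
          (by rw [constFunctional_self]; exact hc _ hlt _ hgS)
        refine ⟨q, holAt_trivial_iff.2 hq, trivial, ?_⟩
        filter_upwards [hsg, hgq, (chartAt ℂ x).open_source.mem_nhds (mem_chart_source ℂ x)]
          with x' hx' hq' hsrc hD
        -- The point `x` is in `D` and `x'` is not, so the coordinate is nonzero at `x'` and the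
        -- powers combine, even for negative `⌊t⌋`.
        have hne : chartAt ℂ x x' - chartAt ℂ x x ≠ 0 := by
          rw [sub_ne_zero]
          intro heq
          exact hD ((chartAt ℂ x).injOn hsrc (mem_chart_source ℂ x) heq ▸ hxD)
        simp only [hx' hD, map_smul, hq', zpow_add_one₀ hne]
        exact (mul_smul _ _ (q x')).symm
  · exact sum_constFunctional_smul_constSection F y b c hsum (hN hx).1 v

end Parabolic

/-! ### Higgs fields and symmetric or antisymmetric tensors -/

theorem mem_tensor_of_sum {X : Type*} [TopologicalSpace X] {D : Finset X} {V W : Cpl D → Type*}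
    [∀ x, AddCommGroup (V x)] [∀ x, Module ℂ (V x)]
    [∀ x, AddCommGroup (W x)] [∀ x, Module ℂ (W x)]
    {P : Filtered D V} {Q : Filtered D W} {t : ℝ} {U : Opens X} {ι : Type*} [Fintype ι]
    (a b : ι → ℝ) (e : ι → ∀ x, V x) (f : ι → ∀ x, W x)
    (h : ∀ k, t ≤ a k + b k ∧ e k ∈ P (a k) U ∧ f k ∈ Q (b k) U)
    {σ : ∀ x, V x ⊗[ℂ] W x} (hσ : ∀ x : Cpl D, x.1 ∈ U → σ x = ∑ k, e k x ⊗ₜ[ℂ] f k x) :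
    σ ∈ tensor P Q t U := by
  let r := (Fintype.equivFin ι).symm
  refine fun y hy => ⟨U, hy, le_rfl, Fintype.card ι, a ∘ r, b ∘ r, e ∘ r, f ∘ r,
    fun k => h (r k), fun x hx => ?_⟩
  rw [hσ x hx, ← r.sum_comp]
  rfl

/-- Sections of `P ⊗ Q ⊗ R` are `δ`-symmetric in every fibre if the sections of `P` are. -/
theorem exchange_eq_of_mem {X : Type*} [TopologicalSpace X] {D : Finset X}
    {E L K : Cpl D → Type*} [∀ x, AddCommGroup (E x)] [∀ x, Module ℂ (E x)]
    [∀ x, AddCommGroup (L x)] [∀ x, Module ℂ (L x)] [∀ x, AddCommGroup (K x)]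
    [∀ x, Module ℂ (K x)] {P : Filtered D (fun x => E x ⊗[ℂ] E x)}
    {Q : Filtered D (fun x => Module.Dual ℂ (L x))} {δ : ℂ}
    (hP : ∀ t U, ∀ σ ∈ P t U, ∀ x : Cpl D, x.1 ∈ U →
      TensorProduct.comm ℂ (E x) (E x) (σ x) = δ • σ x)
    {R : Filtered D K} {t : ℝ}
    {U : Opens X} {T : ∀ x : Cpl D, ((E x ⊗[ℂ] E x) ⊗[ℂ] Module.Dual ℂ (L x)) ⊗[ℂ] K x}
    (hT : T ∈ tensor (tensor P Q) R t U) (x : Cpl D) (hx : x.1 ∈ U) :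
    LinearMap.rTensor _ (exchange (E x) (L x)) (T x) = δ • T x := by
  obtain ⟨N, hxN, -, n, a, b, e, f, hef, hsum⟩ := hT x.1 hx
  rw [hsum x hxN, map_sum, Finset.smul_sum]
  refine Finset.sum_congr rfl fun k _ => ?_
  rw [LinearMap.rTensor_tmul, TensorProduct.smul_tmul']
  congr 1
  obtain ⟨N', hxN', -, n', a', b', e', f', hef', hsum'⟩ := (hef k).2.1 x.1 hxN
  rw [hsum' x hxN', map_sum, Finset.smul_sum]
  refine Finset.sum_congr rfl fun k' _ => ?_
  rw [LinearMap.rTensor_tmul, TensorProduct.smul_tmul', LinearEquiv.coe_coe,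
    hP _ _ _ (hef' k').2.1 x hxN']

/-- If `id = ∑ cᵢ ⊗ eᵢ` on `V` and on the line `L`, then `A ∈ End V` corresponds to
`∑ (A eᵢ ⊗ e⁻¹(cᵢ ⊗ lⱼ)) ⊗ λⱼ`. -/
theorem endEquiv_eq_sum {V L : Type*} [AddCommGroup V] [Module ℂ V] [AddCommGroup L] [Module ℂ L]
    [FiniteDimensional ℂ V] (hL : Module.finrank ℂ L = 1)
    (e : V ≃ₗ[ℂ] Module.Dual ℂ V ⊗[ℂ] L) {I J : Type*} [Fintype I] [Fintype J]
    (b : I → V) (c : I → Module.Dual ℂ V) (hb : ∀ v, ∑ i, c i v • b i = v)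
    (l : J → L) (m : J → Module.Dual ℂ L) (hl : ∀ v, ∑ j, m j v • l j = v) (A : Module.End ℂ V) :
    endEquiv hL e A = ∑ ij : I × J, (A (b ij.1) ⊗ₜ e.symm (c ij.1 ⊗ₜ l ij.2)) ⊗ₜ m ij.2 := by
  have hA : A = ∑ i, dualTensorHom ℂ V V (c i ⊗ₜ A (b i)) := by
    ext v
    conv_lhs => rw [← hb v]
    simp [map_sum, dualTensorHom_apply]
  conv_lhs => rw [hA]
  simp only [map_sum, endEquiv_dualTensorHom hL e l m hl, Fintype.sum_prod_type]

variable {X : Type*} [TopologicalSpace X]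
  [ChartedSpace ℂ X] {D : Finset X}
  {FE : Type*} [NormedAddCommGroup FE] [NormedSpace ℂ FE]
  {E : X → Type*} [∀ x, AddCommGroup (E x)] [∀ x, Module ℂ (E x)]
  [TopologicalSpace (TotalSpace FE E)] [∀ x, TopologicalSpace (E x)] [FiberBundle FE E]
  [VectorBundle ℂ FE E] [ContMDiffVectorBundle ω FE E 𝓘(ℂ, ℂ)]
  {L : X → Type*} [∀ x, AddCommGroup (L x)] [∀ x, Module ℂ (L x)]

/-- Compatibility only has to be tested on vectors of the fibres over `X ∖ D`. -/
theorem isCompatible_iff_fibrewise (φ : ∀ x : Cpl D, E x.1 ⊗[ℂ] E x.1 →ₗ[ℂ] L x.1)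
    (θ : ∀ x : Cpl D, Module.End ℂ (E x.1) ⊗[ℂ] Cotangent x.1) :
    IsCompatible FE φ θ ↔ ∀ (x : Cpl D) (u v : E x.1),
      pairLeft (φ x) (higgsApply (θ x) u) v + pairRight (φ x) u (higgsApply (θ x) v) = 0 := by
  refine ⟨fun h x u v => ?_, fun h U u v _ _ x _ => h x _ _⟩
  -- Any two vectors of a fibre are values of holomorphic sections, namely of constant ones.
  have := h ⟨_, (trivializationAt FE E x.1).open_baseSet⟩ (constSection FE x.1 u)
    (constSection FE x.1 v) (fun y hy => holAt_constSection FE x.1 u hy)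
    (fun y hy => holAt_constSection FE x.1 v hy) x (mem_baseSet_trivializationAt FE E x.1)
  rwa [constSection_self, constSection_self] at this

variable [T1Space X] [IsManifold 𝓘(ℂ, ℂ) ω X] [∀ x, FiniteDimensional ℂ (E x)]
  {FL : Type*} [NormedAddCommGroup FL] [NormedSpace ℂ FL]
  [TopologicalSpace (TotalSpace FL L)] [∀ x, TopologicalSpace (L x)] [FiberBundle FL L]
  [VectorBundle ℂ FL L] [ContMDiffVectorBundle ω FL L 𝓘(ℂ, ℂ)]

/-- For a Higgs field whose tensor is fibrewise `δ`-symmetric (`δ = ±1`), this tensor is a global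
section of the parabolic bundle of `δ`-symmetric tensors. -/
theorem higgsTensor_mem_of_exchange (hL : ∀ x, Module.finrank ℂ (L x) = 1)
    {P : ParabolicStructure D E} {Q : ParabolicStructure D L}
    {θ : ∀ x : Cpl D, Module.End ℂ (E x.1) ⊗[ℂ] Cotangent x.1} (hθ : IsHiggsField FE P θ)
    {φ : ∀ x : Cpl D, E x.1 ⊗[ℂ] E x.1 →ₗ[ℂ] L x.1} (hφ : IsPerfect FE FL P Q φ)
    {δ : ℂ} (hδ : δ * δ = 1) (S : Filtered D (fun x => E x.1 ⊗[ℂ] E x.1))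
    (hS : ∀ t U σ, σ ∈ tensor (P.filtered FE) (P.filtered FE) t U →
      (∀ x : Cpl D, x.1 ∈ U → TensorProduct.comm ℂ (E x.1) (E x.1) (σ x) = δ • σ x) → σ ∈ S t U)
    (hex : ∀ x, LinearMap.rTensor _ (exchange (E x.1) (L x.1)) (higgsTensor hφ hL θ x) =
      δ • higgsTensor hφ hL θ x) :
    higgsTensor hφ hL θ ∈ tensor (tensor S (dual (Q.filtered FL))) (canonicalLog X D) 0 ⊤ := by
  have : ∀ x, FiniteDimensional ℂ (L x) := fun x => Module.finite_of_finrank_eq_succ (hL x)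
  intro y _
  obtain ⟨N₁, hy₁, n, A, η, hAη, hθN⟩ := hθ y
  obtain ⟨N₂, hy₂, k, a, e, c, hec⟩ := P.exists_local_frame (F := FE) y
  obtain ⟨N₃, hy₃, k', b, l, m, hlm⟩ := Q.exists_local_frame (F := FL) y
  obtain ⟨g, hg, hg1, -⟩ := hφ.isIso.2
  let N : Opens X := N₁ ⊓ N₂ ⊓ N₃
  have hN₁ : N ≤ N₁ := inf_le_left.trans inf_le_left
  obtain ⟨hec, hsum⟩ := hec N (inf_le_left.trans inf_le_right)
  obtain ⟨hlm, hsum'⟩ := hlm N inf_le_right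
  let h : Fin k × Fin k' → ∀ x : Cpl D, E x.1 :=
    fun ij x => g x (c ij.1 x.1 ⊗ₜ l ij.2 x.1)
  -- Here the inverse of the adjoint must respect the filtrations, not merely exist in each fibre.
  have hh : ∀ ij, h ij ∈ P.filtered FE (-a ij.1 + b ij.2) N := by
    intro ij
    refine hg _ _ _ (mem_tensor_of_sum (ι := Unit) (fun _ => -a ij.1) (fun _ => b ij.2)
      (fun _ x => c ij.1 x.1) (fun _ x => l ij.2 x.1)
      (fun _ => ⟨le_rfl, (hec _).2, (hlm _).1⟩) fun x _ => by simp)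
  have hgs : ∀ x w, (LinearEquiv.ofBijective (hat (φ x)) (hφ.isIso.bijective x)).symm w =
      g x w := by
    intro x w
    obtain ⟨v, rfl⟩ := (hφ.isIso.bijective x).2 w
    rw [LinearEquiv.symm_apply_eq, LinearEquiv.ofBijective_apply]
    exact congrArg _ (LinearMap.congr_fun (hg1 x) v).symm
  -- Single products `A e ⊗ h` need not be `δ`-symmetric, so each is averaged with `δ` times its
  -- exchange. Both halves have weight `aᵢ + (bⱼ - aᵢ) = bⱼ`.
  let σ : Fin n → Fin k × Fin k' → ∀ x : Cpl D, E x.1 ⊗[ℂ] E x.1 := fun r ij x =>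
    ((1 / 2 : ℂ) • A r x.1 (e ij.1 x.1)) ⊗ₜ h ij x +
      h ij x ⊗ₜ ((δ / 2) • A r x.1 (e ij.1 x.1))
  have hσ : ∀ r ij, σ r ij ∈ S (b ij.2) N := by
    intro r ij
    have hAe := ((hAη r).1.filtered_map hN₁ (hec ij.1).1)
    refine hS _ _ _ (mem_tensor_of_sum (ι := Fin 2) ![a ij.1, -a ij.1 + b ij.2]
      ![-a ij.1 + b ij.2, a ij.1]
      ![fun x => (1 / 2 : ℂ) • A r x.1 (e ij.1 x.1), h ij]
      ![h ij, fun x => (δ / 2) • A r x.1 (e ij.1 x.1)] ?_ ?_) ?_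
    · rw [Fin.forall_fin_two]
      exact ⟨⟨by simp, P.filtered_smul hAe _, hh ij⟩, ⟨by simp, hh ij, P.filtered_smul hAe _⟩⟩
    · intro x _
      simp [σ, Fin.sum_univ_two]
    · intro x _
      simp only [σ, map_add, TensorProduct.comm_tmul, ← TensorProduct.smul_tmul',
        TensorProduct.tmul_smul, map_smul, smul_add, smul_smul]
      rw [add_comm, mul_one_div, ← mul_div_assoc, hδ]
  refine ⟨N, ⟨⟨hy₁, hy₂⟩, hy₃⟩, le_top, n, 0, 0,
    fun r x => ∑ ij, σ r ij x ⊗ₜ m ij.2 x.1, η, fun r => ⟨by simp, ?_, ?_⟩, fun x hx => ?_⟩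
  · exact mem_tensor_of_sum (fun ij => b ij.2) (fun ij => -b ij.2) (σ r)
      (fun ij x => m ij.2 x.1) (fun ij => ⟨by simp, hσ r ij, (hlm _).2⟩) fun x _ => rfl
  · exact fun z hz => (hAη r).2 z (hN₁ hz)
  · have hT : higgsTensor hφ hL θ x =
        ∑ r, (∑ ij, (A r x.1 (e ij.1 x.1) ⊗ₜ h ij x) ⊗ₜ m ij.2 x.1) ⊗ₜ η r x := by
      rw [higgsTensor, hθN x (hN₁ hx), map_sum]
      refine Finset.sum_congr rfl fun r _ => ?_
      rw [LinearMap.rTensor_tmul, LinearEquiv.coe_coe,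
        endEquiv_eq_sum (hL x.1) _ (fun i => e i x.1) (fun i => c i x.1) (hsum x.1 hx)
          (fun j => l j x.1) (fun j => m j x.1) (hsum' x.1 hx)]
      simp only [hgs, h]
    -- The whole tensor is `δ`-symmetric, so averaging does not change it, although it changes the
    -- individual summands.
    have h2 : higgsTensor hφ hL θ x = (1 / 2 : ℂ) • higgsTensor hφ hL θ x +
        (δ / 2) • LinearMap.rTensor _ (exchange (E x.1) (L x.1)) (higgsTensor hφ hL θ x) := by
      rw [hex, smul_smul, ← add_smul, div_mul_eq_mul_div, hδ, add_halves, one_smul]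
    rw [h2, hT]
    simp only [map_sum, LinearMap.rTensor_tmul, Finset.smul_sum, ← Finset.sum_add_distrib,
      LinearEquiv.coe_coe, TensorProduct.comm_tmul]
    refine Finset.sum_congr rfl fun r _ => ?_
    simp only [TensorProduct.smul_tmul', ← TensorProduct.add_tmul, Finset.smul_sum,
      ← Finset.sum_add_distrib, σ, TensorProduct.tmul_smul]

/-- A `-δ`-symmetric perfect pairing (`δ = ±1`) is compatible with a Higgs field if and only if the
tensor of the Higgs field is a section of the parabolic bundle of `δ`-symmetric tensors. -/
theorem isCompatible_iff_higgsTensor_mem (hL : ∀ x, Module.finrank ℂ (L x) = 1)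
    {P : ParabolicStructure D E} {Q : ParabolicStructure D L}
    {θ : ∀ x : Cpl D, Module.End ℂ (E x.1) ⊗[ℂ] Cotangent x.1} (hθ : IsHiggsField FE P θ)
    {φ : ∀ x : Cpl D, E x.1 ⊗[ℂ] E x.1 →ₗ[ℂ] L x.1} (hφ : IsPerfect FE FL P Q φ)
    {δ : ℂ} (hδ : δ * δ = 1) (hs : ∀ x u v, φ x (u ⊗ₜ v) = -δ • φ x (v ⊗ₜ u))
    (S : Filtered D (fun x => E x.1 ⊗[ℂ] E x.1))
    (hS : ∀ t U σ, σ ∈ S t U ↔ σ ∈ tensor (P.filtered FE) (P.filtered FE) t U ∧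
      ∀ x : Cpl D, x.1 ∈ U → TensorProduct.comm ℂ (E x.1) (E x.1) (σ x) = δ • σ x) :
    IsCompatible FE φ θ ↔
      higgsTensor hφ hL θ ∈ tensor (tensor S (dual (Q.filtered FL))) (canonicalLog X D) 0 ⊤ := by
  rw [isCompatible_iff_fibrewise]
  have key : ∀ x : Cpl D, (∀ u v : E x.1, pairLeft (φ x) (higgsApply (θ x) u) v +
      pairRight (φ x) u (higgsApply (θ x) v) = 0) ↔
      LinearMap.rTensor _ (exchange (E x.1) (L x.1)) (higgsTensor hφ hL θ x) =
        δ • higgsTensor hφ hL θ x := fun x =>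
    compatible_iff_exchange (hL x.1) (φ x) (hφ.isIso.bijective x) δ hδ (hs x) (θ x)
  simp only [key]
  refine ⟨fun h => higgsTensor_mem_of_exchange hL hθ hφ hδ S
    (fun t U σ h1 h2 => (hS t U σ).2 ⟨h1, h2⟩) h, fun h x => ?_⟩
  exact exchange_eq_of_mem (E := fun x : Cpl D => E x.1) (L := fun x : Cpl D => L x.1)
    (K := fun x : Cpl D => Cotangent x.1) (fun t U σ hσ => ((hS t U σ).1 hσ).2) h x trivial

end ParabolicHiggs

open ParabolicHiggs in
theorem mainTheorem5
    {X : Type*} [TopologicalSpace X] [T2Space X] [CompactSpace X] [ConnectedSpace X]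
    [ChartedSpace ℂ X] [IsManifold 𝓘(ℂ, ℂ) ω X] (D : Finset X)
    -- a holomorphic vector bundle `E`
    {FE : Type*} [NormedAddCommGroup FE] [NormedSpace ℂ FE]
    {E : X → Type*} [∀ x, AddCommGroup (E x)] [∀ x, Module ℂ (E x)]
    [TopologicalSpace (TotalSpace FE E)] [∀ x, TopologicalSpace (E x)] [FiberBundle FE E]
    [VectorBundle ℂ FE E] [ContMDiffVectorBundle ω FE E 𝓘(ℂ, ℂ)]
    [∀ x, FiniteDimensional ℂ (E x)]
    -- a holomorphic line bundle `L`
    {FL : Type*} [NormedAddCommGroup FL] [NormedSpace ℂ FL]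
    {L : X → Type*} [∀ x, AddCommGroup (L x)] [∀ x, Module ℂ (L x)]
    [TopologicalSpace (TotalSpace FL L)] [∀ x, TopologicalSpace (L x)] [FiberBundle FL L]
    [VectorBundle ℂ FL L] [ContMDiffVectorBundle ω FL L 𝓘(ℂ, ℂ)]
    (hL : ∀ x, Module.finrank ℂ (L x) = 1)
    -- parabolic structures and a parabolic Higgs field
    (P : ParabolicStructure D E) (Q : ParabolicStructure D L)
    (θ : ∀ x : Cpl D, Module.End ℂ (E x.1) ⊗[ℂ] Cotangent x.1)
    (hθ : IsHiggsField FE P θ)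
    (φ : ∀ x : Cpl D, E x.1 ⊗[ℂ] E x.1 →ₗ[ℂ] L x.1) :
    (∀ hφ : IsSymplectic FE FL P Q φ,
      (IsCompatible FE φ θ ↔
        higgsTensor hφ.toIsPerfect hL θ ∈
          tensor (tensor (sym2 (P.filtered FE)) (dual (Q.filtered FL)))
            (canonicalLog X D) 0 ⊤)) ∧
    (∀ hφ : IsOrthogonal FE FL P Q φ,
      (IsCompatible FE φ θ ↔
        higgsTensor hφ.toIsPerfect hL θ ∈
          tensor (tensor (wedge2 (P.filtered FE)) (dual (Q.filtered FL)))
            (canonicalLog X D) 0 ⊤)) := by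
  constructor
  · intro hφ
    -- The signs are opposite: an antisymmetric `φ` corresponds to symmetric tensors, hence `δ = 1`.
    refine isCompatible_iff_higgsTensor_mem hL hθ hφ.toIsPerfect (δ := 1) (by norm_num)
      (fun x u v => ?_) _ fun t U σ => ?_
    · rw [neg_one_smul]
      exact hφ.antisymm x u v
    · simp only [sym2, Set.mem_ofPred_eq, one_smul]
  · intro hφ
    refine isCompatible_iff_higgsTensor_mem hL hθ hφ.toIsPerfect (δ := -1) (by norm_num)
      (fun x u v => ?_) _ fun t U σ => ?_
    · rw [neg_neg, one_smul]
      exact hφ.symm x u v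
    · simp only [wedge2, Set.mem_ofPred_eq, neg_one_smul]
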